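/- For a cone $C\subset\mathbb R^n$ (the set of nonnegative linear combinations of finitely many vectors) whose linear hull $\operatorname{lin} C$ has dimension $k\ge 1$, let its solid angle be $\alpha_k(C)=\mathbb P[Z\in C]$, where $Z$ is uniformly distributed on the unit sphere of $\operatorname{lin} C$ (so the full angle is $1$); put $\alpha_k(C)=0$ if $\dim\operatorname{lin} C<k$. For a $d$-dimensional simplex $S$ with vertices $x_0,\dots,x_d\in\mathbb R^n$, its solid angle at $x_i$ is $\alpha_d(S,x_i)=\alpha_d(\operatorname{pos}(x_0-x_i,\dots,x_d-x_i))$, where $\operatorname{pos}$ denotes the set of nonnegative linear combinations, and the sum of its solid angles is $\gamma_d(S)=\sum_{i=0}^d\alpha_d(S,x_i)$. Let $d\ge 1$, let $X_0,\dots,X_d$ be independent random points with the standard Gaussian distribution on $\mathbb R^d$, and let $P_d=\operatorname{conv}(X_0,\dots,X_d)$, which is almost surely a $d$-dimensional simplex with these vertices. Then the expected sum of the solid angles of $P_d$ exists and equals the sum of the solid angles of the regular $d$-dimensional simplex: $\mathbb E\,\gamma_d(P_d)=\gamma_d(T)$ for every $d$-dimensional simplex $T$ in some $\mathbb R^n$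 all of whose edges have the same length. In particular, $\mathbb E\,\gamma_d(P_d)=\gamma_d(T^d)$, where $T^d=\operatorname{conv}(e_0,\dots,e_d)$ and $e_0,\dots,e_d$ is the standard orthonormal basis of $\mathbb R^{d+1}$; equivalently (by exchangeability), $\mathbb E\,\alpha_d(P_d,X_0)=\alpha_d(T^d,e_0)$. -/

import Mathlib

open MeasureTheory ProbabilityTheory

noncomputable section

/-- The uniform distribution on the unit sphere of a finite-dimensional Euclidean space `V`: the
surface measure induced by Lebesgue measure, normalised to have total mass `1`
(the space is meant to have dimension at least `1`). -/
def uniformSphere (V : Type*) [NormedAddCommGroup V] [InnerProductSpace ℝ V]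
    [FiniteDimensional ℝ V] [MeasurableSpace V] [BorelSpace V] :
    Measure (Metric.sphere (0 : V) 1) :=
  ((volume : Measure V).toSphere Set.univ)⁻¹ • (volume : Measure V).toSphere

section Angles

variable {E : Type*} [NormedAddCommGroup E] [InnerProductSpace ℝ E]
  [FiniteDimensional ℝ E] [MeasurableSpace E] [BorelSpace E]

open Classical in
/-- The `k`-dimensional solid angle `α_k(C)` of a cone `C`: if the linear hull of `C` has
dimension `k`, it is the probability that a uniformly distributed point of the unit sphere of the
linear hull lies in `C`. It is `0` if the linear hull has another dimension, in particular if `C`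
is of lower dimension than `k`. -/
def solidAngle (k : ℕ) (C : Set E) : ℝ :=
  if Module.finrank ℝ (Submodule.span ℝ C) = k then
    (uniformSphere (Submodule.span ℝ C)).real
      {z : Metric.sphere (0 : Submodule.span ℝ C) 1 | ((z : Submodule.span ℝ C) : E) ∈ C}
  else 0

/-- The positive (conic) hull of a finite family of vectors. -/
def posHull {ι : Type*} (v : ι → E) : Set E :=
  (PointedCone.hull ℝ (Set.range v) : Set E)

/-- The solid angle `α_d(S, x i)`, at the vertex `x i`, of the `d`-dimensional simplex `S` with
vertices `x 0, …, x d`. -/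
def vertexAngle {d : ℕ} (x : Fin (d + 1) → E) (i : Fin (d + 1)) : ℝ :=
  solidAngle d (posHull fun j => x j - x i)

/-- The sum `γ_d(S)` of the solid angles of the `d`-dimensional simplex `S` with vertices
`x 0, …, x d`. -/
def angleSum {d : ℕ} (x : Fin (d + 1) → E) : ℝ :=
  ∑ i, vertexAngle x i

end Angles

/-- The vertices of the regular `d`-dimensional simplex `T^d` in `ℝ^(d+1)`: the standard
orthonormal basis. -/
def regularVertices (d : ℕ) (i : Fin (d + 1)) : EuclideanSpace ℝ (Fin (d + 1)) :=
  EuclideanSpace.single i 1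

end

/-! Every simplex is parametrised by one space: with H the sum-zero vectors of ℝ^(d+1), let L_x : H
→ E send h to ∑ h_j x_j. For affinely independent x, L_x is injective and the cone at x_i pulls back
to a fixed cone K_i, independent of x (`combination_mem_posHull_iff`). Solid angles are Gaussian
measures of cones (`solidAngle_eq_stdGaussian`).

For a regular simplex, L_t is a multiple of an isometry (`norm_combination_sq`), so its angle is the
Gaussian measure of K_i.

For Gaussian points, the angle is the probability that an independent Gaussian Z lies in the random
cone. By Fubini, fix Z = z ≠ 0 and randomise x instead: the event becomes L_x⁻¹ z ∈ K_i. Since L_x ∘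
Q has the law of L_x for every isometry Q of H, the vector L_x⁻¹ z has an isometry-invariant law, so
it lies in K_i with the same Gaussian probability (`pi_stdGaussian_mem_posHull`). -/

/-! ### Isometry-invariant measures and cones -/

/-- The reflection in the hyperplane orthogonal to x - y carries x to y. -/
lemma charFun_eq_of_norm_eq {V : Type*} [NormedAddCommGroup V] [InnerProductSpace ℝ V]
    [FiniteDimensional ℝ V] [MeasurableSpace V] [BorelSpace V] {μ : Measure V}
    (hμ : ∀ Q : V ≃ₗᵢ[ℝ] V, μ.map Q = μ) {x y : V} (h : ‖x‖ = ‖y‖) :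
    charFun μ x = charFun μ y := by
  set Q : V ≃ₗᵢ[ℝ] V := (ℝ ∙ (x - y))ᗮ.reflection with hQ
  have hxy : Q x = y := Submodule.reflection_sub h
  have hQm : AEMeasurable Q μ := Q.continuous.measurable.aemeasurable
  rw [← hxy]
  conv_rhs => rw [← hμ Q]
  rw [charFun_apply, charFun_apply, integral_map hQm (by fun_prop)]
  simp [LinearIsometryEquiv.inner_map_map]

/-- An isometry-invariant probability measure on the unit sphere is unique. -/
lemma eq_of_map_isometry_eq_of_ae_norm_eq_one {V : Type*} [NormedAddCommGroup V]
    [InnerProductSpace ℝ V] [FiniteDimensional ℝ V] [MeasurableSpace V] [BorelSpace V]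
    {μ ν : Measure V} [IsProbabilityMeasure μ] [IsProbabilityMeasure ν]
    (hμ : ∀ Q : V ≃ₗᵢ[ℝ] V, μ.map Q = μ) (hν : ∀ Q : V ≃ₗᵢ[ℝ] V, ν.map Q = ν)
    (hμ1 : ∀ᵐ x ∂μ, ‖x‖ = 1) (hν1 : ∀ᵐ x ∂ν, ‖x‖ = 1) : μ = ν := by
  -- The characteristic function of ρ is radial, so it may be averaged over directions drawn from σ.
  -- The resulting double integral is symmetric in ρ and σ up to Fubini.
  have key : ∀ (ρ σ : Measure V) [IsProbabilityMeasure ρ] [IsProbabilityMeasure σ],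
      (∀ Q : V ≃ₗᵢ[ℝ] V, ρ.map Q = ρ) → (∀ᵐ x ∂σ, ‖x‖ = 1) → ∀ y : V,
      charFun ρ y = ∫ x, ∫ z, Complex.exp (inner ℝ z (‖y‖ • x) * Complex.I) ∂ρ ∂σ := by
    intro ρ σ _ _ hρ hσ y
    have : ∀ᵐ x ∂σ, ∫ z, Complex.exp (inner ℝ z (‖y‖ • x) * Complex.I) ∂ρ = charFun ρ y := by
      filter_upwards [hσ] with x hx
      rw [← charFun_apply]
      exact charFun_eq_of_norm_eq hρ (by simp [norm_smul, hx])
    rw [integral_congr_ae this]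
    simp
  apply Measure.ext_of_charFun
  ext y
  rw [key μ ν hμ hν1 y, key ν μ hν hμ1 y, integral_integral_swap]
  · simp only [real_inner_smul_right, real_inner_comm]
  · refine Integrable.of_bound (C := 1) (Measurable.aestronglyMeasurable ?_) ?_
    · fun_prop
    · exact Filter.Eventually.of_forall fun p => by
        simp [Function.uncurry, Complex.norm_exp_ofReal_mul_I]

/-- Isometry-invariant probability measures without mass at `0` agree on measurable cones. -/
lemma measure_cone_eq_of_map_isometry_eq {V : Type*} [NormedAddCommGroup V]
    [InnerProductSpace ℝ V] [FiniteDimensional ℝ V] [MeasurableSpace V] [BorelSpace V]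
    {μ ν : Measure V} [IsProbabilityMeasure μ] [IsProbabilityMeasure ν]
    (hμ : ∀ Q : V ≃ₗᵢ[ℝ] V, μ.map Q = μ) (hν : ∀ Q : V ≃ₗᵢ[ℝ] V, ν.map Q = ν)
    (hμ0 : μ {0} = 0) (hν0 : ν {0} = 0) {C : Set V} (hC : MeasurableSet C)
    (hcone : ∀ c : ℝ, 0 < c → ∀ x ∈ C, c • x ∈ C) : μ C = ν C := by
  -- Radial projection to the sphere; the value N 0 = 0 does no harm because the origin has mass
  -- zero.
  set N : V → V := fun x => ‖x‖⁻¹ • x with hN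
  have hNm : Measurable N := by fun_prop
  have inv : ∀ ρ : Measure V, (∀ Q : V ≃ₗᵢ[ℝ] V, ρ.map Q = ρ) →
      ∀ Q : V ≃ₗᵢ[ℝ] V, (ρ.map N).map Q = ρ.map N := by
    intro ρ hρ Q
    have hQm : Measurable Q := Q.continuous.measurable
    rw [Measure.map_map hQm hNm]
    conv_rhs => rw [← hρ Q, Measure.map_map hNm hQm]
    congr 1
    ext x
    simp [hN]
  have norm_one : ∀ ρ : Measure V, ρ {0} = 0 → ∀ᵐ x ∂(ρ.map N), ‖x‖ = 1 := by
    intro ρ hρ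
    rw [ae_map_iff hNm.aemeasurable (measurableSet_eq_fun (by fun_prop) (by fun_prop))]
    have : ∀ᵐ x ∂ρ, x ≠ 0 := by simpa [ae_iff] using hρ
    filter_upwards [this] with x hx
    simp [hN, norm_smul, hx]
  have val : ∀ ρ : Measure V, ρ {0} = 0 → ρ.map N C = ρ C := by
    intro ρ hρ
    rw [Measure.map_apply hNm hC]
    apply measure_congr
    have : ∀ᵐ x ∂ρ, x ≠ 0 := by simpa [ae_iff] using hρ
    filter_upwards [this] with x hx
    have hx' : 0 < ‖x‖ := norm_pos_iff.mpr hx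
    refine propext ⟨fun h => ?_, fun h => hcone _ (inv_pos.mpr hx') x h⟩
    have := hcone ‖x‖ hx' _ h
    rwa [smul_inv_smul₀ hx'.ne'] at this
  have := Measure.isProbabilityMeasure_map (μ := μ) hNm.aemeasurable
  have := Measure.isProbabilityMeasure_map (μ := ν) hNm.aemeasurable
  rw [← val μ hμ0, ← val ν hν0, eq_of_map_isometry_eq_of_ae_norm_eq_one (inv μ hμ) (inv ν hν)
    (norm_one μ hμ0) (norm_one ν hν0)]

/-! ### Solid angles as Gaussian measures -/

/-- A proper affine subspace lies in a level set of a nonzero functional, whose law is a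
nondegenerate real Gaussian and hence has no atoms. -/
lemma stdGaussian_affineSubspace {V : Type*} [NormedAddCommGroup V]
    [InnerProductSpace ℝ V] [FiniteDimensional ℝ V] [MeasurableSpace V] [BorelSpace V]
    {s : AffineSubspace ℝ V} (hs : s ≠ ⊤) : stdGaussian V (s : Set V) = 0 := by
  rcases s.eq_bot_or_nonempty with rfl | ⟨p, hp⟩
  · simp
  have hdir : s.direction < ⊤ := by
    rw [lt_top_iff_ne_top, Ne, AffineSubspace.direction_eq_top_iff_of_nonempty ⟨p, hp⟩]
    exact hs
  obtain ⟨f, hf0, hf⟩ := Submodule.exists_le_ker_of_lt_top _ hdir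
  set L : StrongDual ℝ V := f.toContinuousLinearMap with hL
  have hL0 : L ≠ 0 := by
    intro h
    exact hf0 (by ext x; simpa [hL] using congrArg (fun l : StrongDual ℝ V => l x) h)
  have hsub : (s : Set V) ⊆ L ⁻¹' {L p} := by
    intro x hx
    have := hf (AffineSubspace.vsub_mem_direction hx hp)
    simpa [hL, sub_eq_zero] using this
  refine measure_mono_null hsub ?_
  rw [← Measure.map_apply L.continuous.measurable (measurableSet_singleton _),
    IsGaussian.map_eq_gaussianReal, variance_dual_stdGaussian]
  have := nullSingletonClass_gaussianReal (μ := (stdGaussian V)[L]) (v := (‖L‖ ^ 2).toNNReal)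
    (by simpa using hL0)
  exact measure_singleton _

lemma stdGaussian_singleton_zero {V : Type*} [NormedAddCommGroup V]
    [InnerProductSpace ℝ V] [FiniteDimensional ℝ V] [MeasurableSpace V] [BorelSpace V]
    [Nontrivial V] : stdGaussian V {0} = 0 := by
  have := stdGaussian_affineSubspace (V := V) (s := (⊥ : Submodule ℝ V).toAffineSubspace) (by
    intro h
    obtain ⟨x, hx⟩ := exists_ne (0 : V)
    have hx' : x ∈ (⊥ : Submodule ℝ V).toAffineSubspace := h ▸ AffineSubspace.mem_top ℝ V x
    exact hx (by simpa using hx'))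
  exact this

lemma map_stdGaussian_isometry {V : Type*} [NormedAddCommGroup V]
    [InnerProductSpace ℝ V] [FiniteDimensional ℝ V] [MeasurableSpace V] [BorelSpace V]
    (Q : V ≃ₗᵢ[ℝ] V) : (stdGaussian V).map Q = stdGaussian V :=
  stdGaussian_map Q

-- `toSphere` measures a set by the volume of the part of the unit ball it spans radially. So the
-- uniform measure of a cone is its share of the ball, and the normalised volume of the ball is
-- isometry-invariant like the Gaussian.
open scoped Pointwise in
lemma uniformSphere_cone {V : Type*} [NormedAddCommGroup V]
    [InnerProductSpace ℝ V] [FiniteDimensional ℝ V] [MeasurableSpace V] [BorelSpace V]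
    [Nontrivial V] {C : Set V} (hC : MeasurableSet C)
    (hcone : ∀ c : ℝ, 0 < c → ∀ x ∈ C, c • x ∈ C) :
    uniformSphere V {z : Metric.sphere (0 : V) 1 | (z : V) ∈ C} = stdGaussian V C := by
  set b : Set V := Metric.ball 0 1
  have hb0 : (volume : Measure V) b ≠ 0 := (Metric.measure_ball_pos _ _ one_pos).ne'
  have hbt : (volume : Measure V) b ≠ ⊤ := measure_ball_lt_top.ne
  have : IsProbabilityMeasure (ProbabilityTheory.cond (volume : Measure V) b) :=
    cond_isProbabilityMeasure_of_finite hb0 hbt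
  have h1 : ProbabilityTheory.cond (volume : Measure V) b C = stdGaussian V C := by
    refine measure_cone_eq_of_map_isometry_eq (fun Q => ?_) map_stdGaussian_isometry ?_
      stdGaussian_singleton_zero hC hcone
    · have hQm : Measurable Q := Q.continuous.measurable
      ext s hs
      rw [Measure.map_apply hQm hs, cond_apply measurableSet_ball, cond_apply measurableSet_ball]
      have : b ∩ Q ⁻¹' s = Q ⁻¹' (b ∩ s) := by
        ext x; simp [b]
      rw [this, Q.measurePreserving.measure_preimage (measurableSet_ball.inter hs).nullMeasurableSet]
    · rw [cond_apply measurableSet_ball]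
      simp
  rw [← h1, cond_apply measurableSet_ball]
  have hS : MeasurableSet {z : Metric.sphere (0 : V) 1 | (z : V) ∈ C} :=
    measurable_subtype_coe hC
  rw [uniformSphere, Measure.smul_apply, smul_eq_mul, Measure.toSphere_apply' _ hS,
    Measure.toSphere_apply_univ]
  have hset : Set.Ioo (0 : ℝ) 1 • ((↑) '' {z : Metric.sphere (0 : V) 1 | (z : V) ∈ C} : Set V)
      = (b ∩ C) \ {0} := by
    ext x
    simp only [Set.mem_smul, Set.mem_image, Set.mem_ofPred_eq, Set.mem_sdiff, Set.mem_inter_iff,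
      Set.mem_singleton_iff, b, mem_ball_zero_iff, Set.mem_Ioo]
    constructor
    · rintro ⟨r, ⟨hr0, hr1⟩, _, ⟨z, hz, rfl⟩, rfl⟩
      have hz1 : ‖(z : V)‖ = 1 := by simp
      refine ⟨⟨by simpa [norm_smul, hz1, abs_of_pos hr0] using hr1, hcone r hr0 _ hz⟩, ?_⟩
      exact smul_ne_zero hr0.ne' (norm_ne_zero_iff.mp (by simp))
    · rintro ⟨⟨hx1, hxC⟩, hx0⟩
      have hx' : 0 < ‖x‖ := norm_pos_iff.mpr hx0
      refine ⟨‖x‖, ⟨hx', hx1⟩, ‖x‖⁻¹ • x, ⟨⟨‖x‖⁻¹ • x, ?_⟩, hcone _ (inv_pos.mpr hx') x hxC, rfl⟩, ?_⟩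
      · simp [norm_smul, hx0]
      · simp [smul_smul, hx'.ne']
  have hnull : (volume : Measure V) ((b ∩ C) \ {0}) = volume (b ∩ C) :=
    measure_sdiff_null (measure_singleton _)
  rw [hset, hnull]
  have hd0 : (Module.finrank ℝ V : ENNReal) ≠ 0 := by
    exact_mod_cast (Module.finrank_pos (R := ℝ) (M := V)).ne'
  have hdt : (Module.finrank ℝ V : ENNReal) ≠ ⊤ := ENNReal.natCast_ne_top _
  rw [ENNReal.mul_inv (Or.inl hd0) (Or.inl hdt), mul_mul_mul_comm, ENNReal.inv_mul_cancel hd0 hdt,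
    one_mul]

/-- Replaces the linear hull, a type depending on C, by a fixed model space H. -/
lemma solidAngle_eq_stdGaussian {E H : Type*} [NormedAddCommGroup E] [InnerProductSpace ℝ E]
    [FiniteDimensional ℝ E] [MeasurableSpace E] [BorelSpace E]
    [NormedAddCommGroup H] [InnerProductSpace ℝ H]
    [FiniteDimensional ℝ H] [MeasurableSpace H] [BorelSpace H] [Nontrivial H]
    (f : H →ₗᵢ[ℝ] E) {C : Set E} (hC : MeasurableSet C)
    (hcone : ∀ c : ℝ, 0 < c → ∀ x ∈ C, c • x ∈ C)
    (hf : f.toLinearMap.range = Submodule.span ℝ C) :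
    solidAngle (Module.finrank ℝ H) C = (stdGaussian H).real (f ⁻¹' C) := by
  set e : H ≃ₗᵢ[ℝ] Submodule.span ℝ C :=
    f.equivRange.trans (LinearIsometryEquiv.ofEq _ _ hf) with he
  have hfe : ∀ x, ((e x : Submodule.span ℝ C) : E) = f x := fun x => rfl
  have hfin : Module.finrank ℝ (Submodule.span ℝ C) = Module.finrank ℝ H :=
    e.toLinearEquiv.finrank_eq.symm
  have : Nontrivial (Submodule.span ℝ C) := e.toEquiv.symm.nontrivial
  have hC' : MeasurableSet ((↑) ⁻¹' C : Set (Submodule.span ℝ C)) := measurable_subtype_coe hC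
  rw [solidAngle, if_pos hfin, measureReal_def, measureReal_def]
  have := uniformSphere_cone (V := Submodule.span ℝ C) hC'
    (fun c hc x hx => by simpa using hcone c hc _ hx)
  simp only [Set.mem_preimage] at this
  rw [this, ← stdGaussian_map e, Measure.map_apply e.continuous.measurable hC']
  rfl

/-! ### Positive hulls and their joint measurability -/

section PosHull

variable {E : Type*} [NormedAddCommGroup E] [InnerProductSpace ℝ E]

lemma mem_posHull_iff {ι : Type*} [Fintype ι] {v : ι → E} {x : E} :
    x ∈ posHull v ↔ ∃ c : ι → ℝ, (∀ j, 0 ≤ c j) ∧ ∑ j, c j • v j = x := by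
  rw [posHull, SetLike.mem_coe, PointedCone.hull, Submodule.mem_span_range_iff_exists_fun]
  constructor
  · rintro ⟨c, rfl⟩
    exact ⟨fun j => c j, fun j => (c j).2, rfl⟩
  · rintro ⟨c, hc, rfl⟩
    exact ⟨fun j => ⟨c j, hc j⟩, rfl⟩

lemma smul_mem_posHull {ι : Type*} [Fintype ι] {v : ι → E} (c : ℝ) (hc : 0 < c) (x : E)
    (hx : x ∈ posHull v) : c • x ∈ posHull v := by
  obtain ⟨a, ha, rfl⟩ := mem_posHull_iff.1 hx
  exact mem_posHull_iff.2 ⟨fun j => c * a j, fun j => mul_nonneg hc.le (ha j), by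
    simp [Finset.smul_sum, mul_smul]⟩

lemma span_posHull {ι : Type*} (v : ι → E) :
    Submodule.span ℝ (posHull v) = Submodule.span ℝ (Set.range v) := by
  apply le_antisymm
  · rw [Submodule.span_le]
    intro x hx
    exact Submodule.span_subset_span (R := {c : ℝ // 0 ≤ c}) (S := ℝ) (s := Set.range v) hx
  · exact Submodule.span_mono Submodule.subset_span

variable [FiniteDimensional ℝ E] [MeasurableSpace E] [BorelSpace E]

/-- Needed for Fubini. The set is a continuous image of a closed subset of a finite-dimensional
space, hence σ-compact. -/
lemma measurableSet_mem_posHull {ι κ : Type*} [Fintype ι] [Fintype κ] {v : (κ → E) → ι → E}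
    (hv : Continuous v) : MeasurableSet {p : (κ → E) × E | p.2 ∈ posHull (v p.1)} := by
  have himg : {p : (κ → E) × E | p.2 ∈ posHull (v p.1)} =
      (fun q : (κ → E) × (ι → ℝ) => (q.1, ∑ j, q.2 j • v q.1 j)) '' {q | ∀ j, 0 ≤ q.2 j} := by
    ext ⟨x, z⟩
    simp only [Set.mem_ofPred_eq, mem_posHull_iff, Set.mem_image, Prod.mk.injEq, Prod.exists]
    constructor
    · rintro ⟨c, hc, h⟩
      exact ⟨x, c, hc, rfl, h⟩
    · rintro ⟨_, c, hc, rfl, h⟩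
      exact ⟨c, hc, h⟩
  rw [himg]
  have hclosed : IsClosed {q : (κ → E) × (ι → ℝ) | ∀ j, 0 ≤ q.2 j} := by
    simp only [Set.ofPred_forall]
    exact isClosed_iInter fun j => isClosed_le (by fun_prop) (by fun_prop)
  have hcont : Continuous fun q : (κ → E) × (ι → ℝ) => (q.1, ∑ j, q.2 j • v q.1 j) := by
    fun_prop
  obtain ⟨K, hK, hU⟩ := (isSigmaCompact_univ.of_isClosed_subset hclosed (Set.subset_univ _)).image hcont
  rw [← hU]
  exact MeasurableSet.iUnion fun n => (hK n).measurableSet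

lemma measurableSet_posHull {ι : Type*} [Fintype ι] (v : ι → E) : MeasurableSet (posHull v) :=
  (measurable_const.prodMk measurable_id : Measurable fun z : E => ((0 : Fin 0 → E), z))
    (measurableSet_mem_posHull (v := fun _ : Fin 0 → E => v) continuous_const)

end PosHull

/-! ### Parametrising simplices by sum-zero vectors -/

/-- The vectors with coordinate sum zero. -/
noncomputable def sumZero (d : ℕ) : Submodule ℝ (EuclideanSpace ℝ (Fin (d + 1))) :=
  LinearMap.ker (∑ j, (EuclideanSpace.proj j : EuclideanSpace ℝ (Fin (d + 1)) →L[ℝ] ℝ)).toLinearMap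

lemma mem_sumZero {d : ℕ} {h : EuclideanSpace ℝ (Fin (d + 1))} :
    h ∈ sumZero d ↔ ∑ j, h j = 0 := by
  simp [sumZero]

lemma finrank_sumZero (d : ℕ) : Module.finrank ℝ (sumZero d) = d := by
  have h0 : (∑ j, (EuclideanSpace.proj j : EuclideanSpace ℝ (Fin (d + 1)) →L[ℝ] ℝ)).toLinearMap
      ≠ 0 := by
    intro h
    have := congrArg (fun l : EuclideanSpace ℝ (Fin (d + 1)) →ₗ[ℝ] ℝ =>
      l (EuclideanSpace.single 0 1)) h
    simp at this
  have := Module.Dual.finrank_ker_add_one_of_ne_zero h0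
  rw [finrank_euclideanSpace_fin] at this
  exact Nat.succ_injective this

/-- The linear map `h ↦ ∑ j, h j • x j` on the vectors with coordinate sum zero. -/
noncomputable def combination {d : ℕ} {E : Type*} [NormedAddCommGroup E] [InnerProductSpace ℝ E]
    (x : Fin (d + 1) → E) : sumZero d →L[ℝ] E :=
  ∑ j, ((EuclideanSpace.proj j : EuclideanSpace ℝ (Fin (d + 1)) →L[ℝ] ℝ).comp
    (sumZero d).subtypeL).smulRight (x j)

section Combination

variable {d : ℕ} {E : Type*} [NormedAddCommGroup E] [InnerProductSpace ℝ E]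

lemma combination_apply (x : Fin (d + 1) → E) (h : sumZero d) :
    combination x h = ∑ j, (h : EuclideanSpace ℝ (Fin (d + 1))) j • x j := by
  simp [combination]

lemma continuous_combination :
    Continuous (combination : (Fin (d + 1) → E) → sumZero d →L[ℝ] E) := by
  refine continuous_finsetSum _ fun j _ => ?_
  exact (ContinuousLinearMap.smulRightL ℝ (sumZero d) E _).continuous.comp (continuous_apply j)

lemma combination_apply_eq_sum_sub (x : Fin (d + 1) → E) (i : Fin (d + 1)) (h : sumZero d) :
    combination x h = ∑ j, (h : EuclideanSpace ℝ (Fin (d + 1))) j • (x j - x i) := by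
  simp [combination_apply, smul_sub, ← Finset.sum_smul, mem_sumZero.1 h.2]

lemma combination_injective {x : Fin (d + 1) → E} (hx : AffineIndependent ℝ x) :
    Function.Injective (combination x) := by
  rw [injective_iff_map_eq_zero]
  intro h hh
  rw [combination_apply] at hh
  ext j
  exact affineIndependent_iff.1 hx Finset.univ _ (mem_sumZero.1 h.2) hh j (Finset.mem_univ j)

lemma combination_mem_posHull_iff {x : Fin (d + 1) → E} (hx : AffineIndependent ℝ x)
    (i : Fin (d + 1)) (h : sumZero d) :
    combination x h ∈ posHull (fun j => x j - x i) ↔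
      ∀ j, j ≠ i → 0 ≤ (h : EuclideanSpace ℝ (Fin (d + 1))) j := by
  rw [mem_posHull_iff]
  constructor
  · rintro ⟨c, hc, hch⟩ j hj
    -- Moving the total weight of c onto x i turns the two representations into one sum-zero
    -- relation; only the i-th coefficient is altered.
    have := affineIndependent_iff.1 hx Finset.univ
      (fun j => c j - (h : EuclideanSpace ℝ (Fin (d + 1))) j - (Pi.single i (∑ k, c k) : _ → ℝ) j)
      (by simp [Finset.sum_sub_distrib, mem_sumZero.1 h.2])
      (by
        simp only [sub_smul, Finset.sum_sub_distrib]
        rw [← combination_apply, ← hch]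
        simp [smul_sub, Finset.sum_sub_distrib, Pi.single_apply, ite_smul, ← Finset.sum_smul])
      j (Finset.mem_univ j)
    simp only [Pi.single_eq_of_ne hj, sub_zero] at this
    linarith [hc j]
  · intro hh
    refine ⟨Function.update (fun j => (h : EuclideanSpace ℝ (Fin (d + 1))) j) i 0, fun j => ?_, ?_⟩
    · by_cases hj : j = i
      · subst hj; simp
      · simpa [hj] using hh j hj
    · rw [combination_apply_eq_sum_sub x i]
      refine Finset.sum_congr rfl fun j _ => ?_
      by_cases hj : j = i
      · subst hj; simp
      · simp [hj]

lemma range_combination (x : Fin (d + 1) → E) (i : Fin (d + 1)) :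
    (combination x).toLinearMap.range = Submodule.span ℝ (Set.range fun j => x j - x i) := by
  apply le_antisymm
  · rintro _ ⟨h, rfl⟩
    rw [ContinuousLinearMap.coe_coe, combination_apply_eq_sum_sub x i]
    exact Submodule.sum_mem _ fun j _ =>
      Submodule.smul_mem _ _ (Submodule.subset_span (Set.mem_range_self j))
  · rw [Submodule.span_le]
    rintro _ ⟨j, rfl⟩
    refine ⟨⟨EuclideanSpace.single j 1 - EuclideanSpace.single i 1, ?_⟩, ?_⟩
    · simp [mem_sumZero, Finset.sum_sub_distrib]
    · simp [combination_apply, sub_smul, Finset.sum_sub_distrib, ite_smul]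

/-- For sum-zero weights, the squared norm is -1/2 times the sum of w_j w_k ‖t_j - t_k‖². Replacing
every squared distance by r² would give 0, so only the diagonal correction survives. -/
lemma norm_combination_sq {t : Fin (d + 1) → E} {r : ℝ}
    (hr : ∀ i j, i ≠ j → dist (t i) (t j) = r) (h : sumZero d) :
    ‖combination t h‖ ^ 2 = r ^ 2 / 2 * ‖h‖ ^ 2 := by
  have hs := mem_sumZero.1 h.2
  set w : Fin (d + 1) → ℝ := fun j => (h : EuclideanSpace ℝ (Fin (d + 1))) j with hw
  have hterm : ∀ j k, w j * w k * (‖t j - t k‖ * ‖t j - t k‖) =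
      w j * w k * r ^ 2 - if j = k then w j * w k * r ^ 2 else 0 := by
    intro j k
    split_ifs with hjk
    · simp [hjk]
    · rw [← dist_eq_norm, hr j k hjk]; ring
  have hww : ∑ j, ∑ k, w j * w k * r ^ 2 = 0 := by
    simp only [← Finset.sum_mul, ← Finset.mul_sum]
    rw [show ∑ j, w j = 0 from hs]; simp
  rw [← real_inner_self_eq_norm_sq, combination_apply,
    inner_sum_smul_sum_smul_of_sum_eq_zero (ι₁ := Fin (d + 1)) (ι₂ := Fin (d + 1)) (w₁ := w) t hs
      (w₂ := w) t hs, Submodule.coe_norm, EuclideanSpace.real_norm_sq_eq]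
  simp only [hterm, Finset.sum_sub_distrib]
  rw [hww]
  simp only [Finset.sum_ite_eq, Finset.mem_univ, if_true, ← Finset.sum_mul]
  simp only [hw, ← sq]
  ring

variable [FiniteDimensional ℝ E]

lemma isInvertible_combination (hd : Module.finrank ℝ E = d) {x : Fin (d + 1) → E}
    (hx : AffineIndependent ℝ x) : (combination x).IsInvertible := by
  have hfin : Module.finrank ℝ (sumZero d) = Module.finrank ℝ E := by rw [finrank_sumZero, hd]
  refine ⟨(LinearMap.linearEquivOfInjective (combination x).toLinearMap
    (combination_injective hx) hfin).toContinuousLinearEquiv, ?_⟩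
  ext h
  rfl

/-- The cone of the vectors with coordinate sum zero whose coordinates other than the `i`-th are
nonnegative. -/
def vertexCone (d : ℕ) (i : Fin (d + 1)) : Set (sumZero d) :=
  {h | ∀ j, j ≠ i → 0 ≤ (h : EuclideanSpace ℝ (Fin (d + 1))) j}

lemma measurableSet_vertexCone (i : Fin (d + 1)) : MeasurableSet (vertexCone d i) := by
  refine IsClosed.measurableSet ?_
  simp only [vertexCone, Set.ofPred_forall]
  exact isClosed_iInter fun j => isClosed_iInter fun _ =>
    isClosed_le continuous_const (by fun_prop)

lemma smul_mem_vertexCone (i : Fin (d + 1)) (c : ℝ) (hc : 0 < c) (h : sumZero d)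
    (hh : h ∈ vertexCone d i) : c • h ∈ vertexCone d i :=
  fun j hj => mul_nonneg hc.le (hh j hj)

lemma nontrivial_sumZero (hd : 1 ≤ d) : Nontrivial (sumZero d) :=
  Module.nontrivial_of_finrank_pos (R := ℝ) (by rw [finrank_sumZero]; exact hd)

variable [MeasurableSpace E] [BorelSpace E]

/-- The solid angles of a regular simplex. -/
lemma vertexAngle_of_dist_eq (hd : 1 ≤ d) {t : Fin (d + 1) → E} (ht : AffineIndependent ℝ t)
    {r : ℝ} (hr : ∀ i j, i ≠ j → dist (t i) (t j) = r) (i : Fin (d + 1)) :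
    vertexAngle t i = (stdGaussian (sumZero d)).real (vertexCone d i) := by
  have := nontrivial_sumZero hd
  have hr0 : 0 < r := by
    have h01 : (0 : Fin (d + 1)) ≠ Fin.last d := by
      rw [Ne, Fin.ext_iff]; simp; omega
    rw [← hr _ _ h01, dist_pos]
    exact fun h => h01 (ht.injective h)
  -- The factor that cancels r² / 2 in `norm_combination_sq`.
  set c : ℝ := √2 / r with hc
  have hc0 : 0 < c := by positivity
  let f : sumZero d →ₗᵢ[ℝ] E :=
    { toLinearMap := c • (combination t).toLinearMap
      norm_map' := fun h => by
        rw [← sq_eq_sq₀ (norm_nonneg _) (norm_nonneg _)]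
        simp only [LinearMap.smul_apply, ContinuousLinearMap.coe_coe, norm_smul, mul_pow,
          norm_combination_sq hr, Real.norm_eq_abs, sq_abs, hc, div_pow]
        rw [Real.sq_sqrt (by norm_num)]
        field_simp }
  have hf : ∀ h, f h = combination t (c • h) := fun h => by simp [f]
  have key := solidAngle_eq_stdGaussian f (measurableSet_posHull fun j => t j - t i)
    smul_mem_posHull (by
      rw [span_posHull, ← range_combination t i]
      exact LinearMap.range_smul _ _ hc0.ne')
  rw [finrank_sumZero] at key
  rw [vertexAngle, key]
  congr 1
  ext h
  rw [Set.mem_preimage, hf, combination_mem_posHull_iff ht]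
  simp [vertexCone, hc0]

lemma vertexAngle_eq_stdGaussian_posHull (hd : 1 ≤ d) (hE : Module.finrank ℝ E = d)
    {x : Fin (d + 1) → E} (hx : AffineIndependent ℝ x) (i : Fin (d + 1)) :
    vertexAngle x i = (stdGaussian E).real (posHull fun j => x j - x i) := by
  have : Nontrivial E := Module.nontrivial_of_finrank_pos (R := ℝ) (by omega)
  have h := solidAngle_eq_stdGaussian (LinearIsometry.id : E →ₗᵢ[ℝ] E)
    (measurableSet_posHull fun j => x j - x i) smul_mem_posHull (by
      rw [span_posHull, ← range_combination x i]
      obtain ⟨e, he⟩ := isInvertible_combination hE hx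
      rw [← he]
      exact LinearMap.range_id.trans (LinearMap.range_eq_top.2 e.surjective).symm)
  rw [hE] at h
  exact h

end Combination

/-! ### Gaussian points: general position and invariance -/

lemma affineIndependent_of_tail {E : Type*} [NormedAddCommGroup E] [InnerProductSpace ℝ E]
    {n : ℕ} {p : Fin (n + 1) → E}
    (ht : AffineIndependent ℝ (Fin.tail p)) (h0 : p 0 ∉ affineSpan ℝ (Set.range (Fin.tail p))) :
    AffineIndependent ℝ p := by
  have hsub : (fun x : { y : Fin (n + 1) // y ≠ 0 } => p x) =
      Fin.tail p ∘ (finSuccAboveEquiv (0 : Fin (n + 1))).symm := by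
    ext1 y
    obtain ⟨z, rfl⟩ := (finSuccAboveEquiv (0 : Fin (n + 1))).surjective y
    rw [Function.comp_apply, Equiv.symm_apply_apply]
    simp [Fin.tail, finSuccAboveEquiv_apply]
  have himg : p '' {x | x ≠ 0} = Set.range (Fin.tail p) := by
    ext x
    constructor
    · rintro ⟨y, hy, rfl⟩
      obtain ⟨z, rfl⟩ := Fin.exists_succ_eq.2 hy
      exact ⟨z, rfl⟩
    · rintro ⟨z, rfl⟩
      exact ⟨z.succ, Fin.succ_ne_zero z, rfl⟩
  refine AffineIndependent.affineIndependent_of_notMem_span (i := 0) ?_ (by rwa [himg])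
  rw [hsub]
  exact ht.comp_embedding (finSuccAboveEquiv (0 : Fin (n + 1))).symm.toEmbedding

lemma affineSpan_range_ne_top {E : Type*} [NormedAddCommGroup E] [InnerProductSpace ℝ E]
    {n : ℕ} (hn : n ≤ Module.finrank ℝ E) (p : Fin n → E) :
    affineSpan ℝ (Set.range p) ≠ ⊤ := by
  intro h
  have hv : vectorSpan ℝ (Set.range p) = ⊤ := by
    rw [← direction_affineSpan, h, AffineSubspace.direction_top]
  rcases n with _ | n
  · have := congrArg (fun s : AffineSubspace ℝ E => (s : Set E)) h
    simp only [Set.range_eq_empty, AffineSubspace.span_empty, AffineSubspace.bot_coe,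
      AffineSubspace.top_coe] at this
    exact Set.empty_ne_univ this
  · have := finrank_vectorSpan_range_le ℝ p (n := n) (by simp)
    rw [hv, finrank_top] at this
    omega

section GaussianPoints

variable {d : ℕ} {E : Type*} [NormedAddCommGroup E] [InnerProductSpace ℝ E]
  [FiniteDimensional ℝ E] [MeasurableSpace E] [BorelSpace E]

lemma ae_affineIndependent_pi_stdGaussian (n : ℕ) (hn : n ≤ Module.finrank ℝ E + 1) :
    ∀ᵐ x ∂(Measure.pi fun _ : Fin n => stdGaussian E), AffineIndependent ℝ x := by
  induction n with
  | zero => exact Filter.Eventually.of_forall fun x => affineIndependent_of_subsingleton ℝ x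
  | succ n ih =>
    have ih := ih (by omega)
    have hmp := measurePreserving_piFinSuccAbove (fun _ : Fin (n + 1) => stdGaussian E) 0
    set e := MeasurableEquiv.piFinSuccAbove (fun _ : Fin (n + 1) => E) 0
    have hmeas : MeasurableSet {x : Fin (n + 1) → E | AffineIndependent ℝ x} :=
      isOpen_setOfPred_affineIndependent.measurableSet
    have hmeas' : MeasurableSet {q | AffineIndependent ℝ (e.symm q)} := e.symm.measurable hmeas
    have hgood : ∀ᵐ q ∂((stdGaussian E).prod (Measure.pi fun _ : Fin n => stdGaussian E)),
        AffineIndependent ℝ (e.symm q) := by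
      rw [Measure.ae_prod_iff_ae_ae hmeas',
        Measure.ae_ae_comm hmeas']
      filter_upwards [ih] with y hy
      -- Given the other n ≤ dim E points, whose affine span is proper, the new point almost surely
      -- avoids that span.
      have hnull := stdGaussian_affineSubspace (affineSpan_range_ne_top (by omega) y)
      filter_upwards [compl_mem_ae_iff.2 hnull] with x hx
      exact affineIndependent_of_tail hy hx
    have := hmp.quasiMeasurePreserving.ae hgood
    simpa using this

/-- Makes the isometry invariance of the standard Gaussian available for the joint law of the
points. -/
lemma map_toLp_pi_stdGaussian {ι : Type*} [Fintype ι] :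
    (Measure.pi fun _ : ι => stdGaussian E).map (WithLp.toLp 2) =
      stdGaussian (PiLp 2 fun _ : ι => E) := by
  apply Measure.ext_of_charFun
  ext t
  rw [charFun_pi]
  simp_rw [charFun_stdGaussian, ← Complex.exp_sum, ← Complex.ofReal_pow, PiLp.norm_sq_eq_of_L2]
  simp [Finset.sum_div, neg_div]

/-- The action of a linear isometry of `ℝ^ι` on families of vectors by mixing. -/
noncomputable def mixIsometry {ι : Type*} [Fintype ι] [DecidableEq ι]
    (W : EuclideanSpace ℝ ι →ₗᵢ[ℝ] EuclideanSpace ℝ ι) :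
    (PiLp 2 fun _ : ι => E) →ₗᵢ[ℝ] PiLp 2 fun _ : ι => E where
  toFun x := WithLp.toLp 2 fun j => ∑ k, W (EuclideanSpace.single j 1) k • x k
  map_add' x y := by ext j; simp [Finset.sum_add_distrib]
  map_smul' c x := by ext j; simp [Finset.smul_sum, smul_comm c]
  norm_map' x := by
    -- The images W e_j form an orthonormal basis; this is Parseval for e_k and e_l.
    have hW : ∀ k l, ∑ j, W (EuclideanSpace.single j 1) k * W (EuclideanSpace.single j 1) l =
        if k = l then 1 else 0 := by
      intro k l
      have := ((EuclideanSpace.basisFun ι ℝ).map (W.toLinearIsometryEquiv rfl)).sum_inner_mul_inner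
        (EuclideanSpace.single k 1) (EuclideanSpace.single l 1)
      simpa [EuclideanSpace.inner_single_left, EuclideanSpace.inner_single_right, Pi.single_apply,
        eq_comm] using this
    rw [← sq_eq_sq₀ (norm_nonneg _) (norm_nonneg _), PiLp.norm_sq_eq_of_L2,
      PiLp.norm_sq_eq_of_L2]
    have : ∀ j, ‖∑ k, W (EuclideanSpace.single j 1) k • x k‖ ^ 2 = ∑ k, ∑ l,
        (W (EuclideanSpace.single j 1) k * W (EuclideanSpace.single j 1) l) *
          inner ℝ (x k) (x l) := by
      intro j
      rw [← real_inner_self_eq_norm_sq, sum_inner]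
      simp_rw [inner_sum, real_inner_smul_left, real_inner_smul_right, mul_assoc]
    simp only [LinearMap.coe_mk, AddHom.coe_mk, this]
    rw [Finset.sum_comm]
    refine Finset.sum_congr rfl fun k _ => ?_
    rw [Finset.sum_comm]
    simp [← Finset.sum_mul, hW]

/-- Extend Q to an isometry W of ℝ^(d+1) and mix the points by W: this is an isometry of the ℓ² sum,
so it preserves the Gaussian law, and on sum-zero weights it acts as Q. -/
lemma exists_measurePreserving_combination_comp (Q : sumZero d ≃ₗᵢ[ℝ] sumZero d) :
    ∃ Φ : (Fin (d + 1) → E) → Fin (d + 1) → E,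
      MeasurePreserving Φ (Measure.pi fun _ => stdGaussian E) (Measure.pi fun _ => stdGaussian E) ∧
      ∀ x, combination (Φ x) = combination x ∘L (Q.toContinuousLinearEquiv : _ →L[ℝ] _) := by
  set W := LinearIsometry.extend ((sumZero d).subtypeₗᵢ.comp Q.toLinearIsometry) with hW
  have hWQ : ∀ h : sumZero d, W h = Q h := fun h => by
    rw [hW, LinearIsometry.extend_apply]; rfl
  set U : (PiLp 2 fun _ : Fin (d + 1) => E) ≃ₗᵢ[ℝ] PiLp 2 fun _ : Fin (d + 1) => E :=
    (mixIsometry W).toLinearIsometryEquiv rfl with hU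
  have h1 : MeasurePreserving (WithLp.toLp 2) (Measure.pi fun _ : Fin (d + 1) => stdGaussian E)
      (stdGaussian (PiLp 2 fun _ : Fin (d + 1) => E)) :=
    ⟨(MeasurableEquiv.toLp 2 _).measurable, map_toLp_pi_stdGaussian⟩
  have h2 : MeasurePreserving U (stdGaussian (PiLp 2 fun _ : Fin (d + 1) => E)) (stdGaussian _) :=
    ⟨U.continuous.measurable, map_stdGaussian_isometry U⟩
  have h3 := MeasurePreserving.symm (MeasurableEquiv.toLp 2 (Fin (d + 1) → E)) h1
  refine ⟨_, h3.comp (h2.comp h1), fun x => ?_⟩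
  ext h
  have hh : ∀ k, (Q h : EuclideanSpace ℝ (Fin (d + 1))) k =
      ∑ j, (h : EuclideanSpace ℝ (Fin (d + 1))) j * W (EuclideanSpace.single j 1) k := by
    intro k
    rw [← hWQ]
    conv_lhs => rw [← (EuclideanSpace.basisFun (Fin (d + 1)) ℝ).sum_repr
      (h : EuclideanSpace ℝ (Fin (d + 1)))]
    simp [map_sum]
  rw [ContinuousLinearMap.comp_apply, combination_apply, combination_apply]
  have hΦ : ∀ j, ((MeasurableEquiv.toLp 2 (Fin (d + 1) → E)).symm ∘ ⇑U ∘ WithLp.toLp 2) x j =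
      ∑ k, W (EuclideanSpace.single j 1) k • x k := fun j => rfl
  simp only [hΦ, Finset.smul_sum, ContinuousLinearEquiv.coe_coe,
    LinearIsometryEquiv.coe_toContinuousLinearEquiv, hh, Finset.sum_smul, smul_smul]
  exact Finset.sum_comm

/-- The preimage of a fixed vector under a Gaussian linear map is isometry-invariant, so that it
lies in the vertex cone with the same probability as a standard Gaussian vector. -/
lemma pi_stdGaussian_mem_posHull (hd : 1 ≤ d) (hE : Module.finrank ℝ E = d) {z : E} (hz : z ≠ 0)
    (i : Fin (d + 1)) :
    (Measure.pi fun _ : Fin (d + 1) => stdGaussian E) {x | z ∈ posHull fun j => x j - x i} =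
      stdGaussian (sumZero d) (vertexCone d i) := by
  have := nontrivial_sumZero hd
  set μ := Measure.pi fun _ : Fin (d + 1) => stdGaussian E with hμ
  have hgood : ∀ᵐ x ∂μ, AffineIndependent ℝ x :=
    ae_affineIndependent_pi_stdGaussian (d + 1) (by omega)
  set F : (Fin (d + 1) → E) → sumZero d := fun x => (combination x).inverse z with hF
  have hFm : AEMeasurable F μ := by
    have hopen : MeasurableSet {x : Fin (d + 1) → E | AffineIndependent ℝ x} :=
      isOpen_setOfPred_affineIndependent.measurableSet
    -- Inversion is continuous at invertible maps, and these occur on an open set of full measure.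
    have hcont : ContinuousOn F {x | AffineIndependent ℝ x} := by
      intro x hx
      have hinv := (ContinuousLinearMap.IsInvertible.contDiffAt_map_inverse (n := 0)
        (isInvertible_combination hE hx)).continuousAt
      have := (hinv.comp (f := combination) (x := x) continuous_combination.continuousAt)
      exact (this.clm_apply continuousAt_const).continuousWithinAt
    have := hcont.aemeasurable (μ := μ) hopen
    rwa [Measure.restrict_eq_self_of_ae_mem (s := {x | AffineIndependent ℝ x}) hgood] at this
  have := Measure.isProbabilityMeasure_map (μ := μ) hFm
  have hinv : ∀ Q : sumZero d ≃ₗᵢ[ℝ] sumZero d, (μ.map F).map Q = μ.map F := by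
    intro Q
    -- The inverse of L_x ∘ Q⁻¹ is Q ∘ L_x⁻¹, hence `Q.symm`.
    obtain ⟨Φ, hΦ, hΦc⟩ := exists_measurePreserving_combination_comp (E := E) Q.symm
    have hcomp : Q ∘ F = F ∘ Φ := by
      ext1 x
      simp only [hF, Function.comp_apply, hΦc, ContinuousLinearMap.inverse_comp_equiv]
      rfl
    rw [AEMeasurable.map_map_of_aemeasurable Q.continuous.measurable.aemeasurable hFm, hcomp,
      ← AEMeasurable.map_map_of_aemeasurable (by rwa [hΦ.map_eq]) hΦ.measurable.aemeasurable,
      hΦ.map_eq]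
  have hFz : ∀ᵐ x ∂μ, combination x (F x) = z := by
    filter_upwards [hgood] with x hx
    exact (isInvertible_combination hE hx).self_apply_inverse z
  have h0 : μ.map F {0} = 0 := by
    rw [Measure.map_apply_of_aemeasurable hFm (measurableSet_singleton _)]
    refine measure_mono_null (t := {x | ¬ combination x (F x) = z}) (fun x hx h => ?_) hFz
    rw [Set.mem_preimage, Set.mem_singleton_iff] at hx
    rw [hx, map_zero] at h
    exact hz h.symm
  rw [← measure_cone_eq_of_map_isometry_eq hinv map_stdGaussian_isometry h0
    stdGaussian_singleton_zero (measurableSet_vertexCone i) (smul_mem_vertexCone i),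
    Measure.map_apply_of_aemeasurable hFm (measurableSet_vertexCone i)]
  apply measure_congr
  filter_upwards [hgood, hFz] with x hx hxz
  have := combination_mem_posHull_iff hx i (F x)
  rw [hxz] at this
  exact propext this

lemma vertexAngle_ae_eq (hd : 1 ≤ d) (hE : Module.finrank ℝ E = d) (i : Fin (d + 1)) :
    (fun x : Fin (d + 1) → E => vertexAngle x i) =ᵐ[Measure.pi fun _ => stdGaussian E]
      fun x => (stdGaussian E).real (posHull fun j => x j - x i) := by
  filter_upwards [ae_affineIndependent_pi_stdGaussian (E := E) (d + 1) (by omega)] with x hx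
  exact vertexAngle_eq_stdGaussian_posHull hd hE hx i

lemma measurableSet_mem_posHull_sub (i : Fin (d + 1)) :
    MeasurableSet {p : (Fin (d + 1) → E) × E | p.2 ∈ posHull fun j => p.1 j - p.1 i} :=
  measurableSet_mem_posHull (v := fun (x : Fin (d + 1) → E) j => x j - x i) (by fun_prop)

lemma measurable_stdGaussian_posHull_sub (i : Fin (d + 1)) :
    Measurable fun x : Fin (d + 1) → E => stdGaussian E (posHull fun j => x j - x i) :=
  measurable_measure_prodMk_left (measurableSet_mem_posHull_sub i)

lemma integrable_vertexAngle (hd : 1 ≤ d) (hE : Module.finrank ℝ E = d) (i : Fin (d + 1)) :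
    Integrable (fun x : Fin (d + 1) → E => vertexAngle x i)
      (Measure.pi fun _ => stdGaussian E) := by
  refine Integrable.congr ?_ (vertexAngle_ae_eq hd hE i).symm
  refine Integrable.of_bound (C := 1)
    (measurable_stdGaussian_posHull_sub i).ennreal_toReal.aestronglyMeasurable ?_
  exact Filter.Eventually.of_forall fun x => by
    rw [Real.norm_of_nonneg measureReal_nonneg]; exact measureReal_le_one

lemma integral_vertexAngle (hd : 1 ≤ d) (hE : Module.finrank ℝ E = d) (i : Fin (d + 1)) :
    ∫ x : Fin (d + 1) → E, vertexAngle x i ∂(Measure.pi fun _ => stdGaussian E) =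
      (stdGaussian (sumZero d)).real (vertexCone d i) := by
  have : Nontrivial E := Module.nontrivial_of_finrank_pos (R := ℝ) (by omega)
  rw [integral_congr_ae (vertexAngle_ae_eq hd hE i)]
  simp only [measureReal_def]
  rw [integral_toReal (measurable_stdGaussian_posHull_sub i).aemeasurable
    (Filter.Eventually.of_forall fun x => measure_lt_top _ _)]
  congr 1
  have hS := measurableSet_mem_posHull_sub (E := E) i
  have h1 := Measure.prod_apply (μ := Measure.pi fun _ : Fin (d + 1) => stdGaussian E)
    (ν := stdGaussian E) hS
  have h2 := Measure.prod_apply_symm (μ := Measure.pi fun _ : Fin (d + 1) => stdGaussian E)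
    (ν := stdGaussian E) hS
  -- Fubini: after the swap the inner probability is the same for every z ≠ 0.
  refine h1.symm.trans (h2.trans ?_)
  have hne : ∀ᵐ z ∂(stdGaussian E), z ≠ 0 := by
    simpa [ae_iff] using stdGaussian_singleton_zero (V := E)
  rw [lintegral_congr_ae (g := fun _ => stdGaussian (sumZero d) (vertexCone d i))]
  · simp
  · filter_upwards [hne] with z hz
    exact pi_stdGaussian_mem_posHull hd hE hz i

end GaussianPoints

/-! ### The standard regular simplex and the conclusion -/

lemma affineIndependent_regularVertices (d : ℕ) : AffineIndependent ℝ (regularVertices d) := by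
  have h := (EuclideanSpace.basisFun (Fin (d + 1)) ℝ).orthonormal.linearIndependent
  have hfun : ⇑(EuclideanSpace.basisFun (Fin (d + 1)) ℝ) = regularVertices d := by
    ext1 i
    simp [regularVertices]
  rw [hfun] at h
  exact h.affineIndependent

lemma dist_regularVertices (d : ℕ) (i j : Fin (d + 1)) (hij : i ≠ j) :
    dist (regularVertices d i) (regularVertices d j) = √2 := by
  rw [dist_eq_norm, ← sq_eq_sq₀ (norm_nonneg _) (Real.sqrt_nonneg _), Real.sq_sqrt zero_le_two,
    norm_sub_sq_real]
  simp [regularVertices, EuclideanSpace.inner_single_left, hij]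
  norm_num

theorem theorem1 {d : ℕ} (hd : 1 ≤ d) {Ω : Type*} [MeasurableSpace Ω] (P : Measure Ω)
    [IsProbabilityMeasure P] (X : Fin (d + 1) → Ω → EuclideanSpace ℝ (Fin d))
    (hlaw : ∀ i, HasLaw (X i) (stdGaussian (EuclideanSpace ℝ (Fin d))) P)
    (hindep : iIndepFun X P) :
    (∀ᵐ ω ∂P, AffineIndependent ℝ (fun i => X i ω)) ∧
    Integrable (fun ω => angleSum (fun i => X i ω)) P ∧
    (∀ (n : ℕ) (T : Affine.Simplex ℝ (EuclideanSpace ℝ (Fin n)) d), T.Equilateral →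
      ∫ ω, angleSum (fun i => X i ω) ∂P = angleSum T.points) ∧
    ∫ ω, angleSum (fun i => X i ω) ∂P = angleSum (regularVertices d) ∧
    Integrable (fun ω => vertexAngle (fun i => X i ω) 0) P ∧
    ∫ ω, vertexAngle (fun i => X i ω) 0 ∂P = vertexAngle (regularVertices d) 0 := by
  have hE : Module.finrank ℝ (EuclideanSpace ℝ (Fin d)) = d := finrank_euclideanSpace_fin
  have hXm : AEMeasurable (fun ω i => X i ω) P := aemeasurable_pi_lambda _ fun i =>
    (hlaw i).aemeasurable
  have hmap : P.map (fun ω i => X i ω) =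
      Measure.pi fun _ => stdGaussian (EuclideanSpace ℝ (Fin d)) := by
    rw [(iIndepFun_iff_map_fun_eq_pi_map fun i => (hlaw i).aemeasurable).1 hindep]
    simp only [(hlaw _).map_eq]
  have hint : ∀ i, Integrable (fun ω => vertexAngle (fun j => X j ω) i) P := fun i => by
    have := integrable_vertexAngle hd hE i
    rw [← hmap] at this
    exact this.comp_aemeasurable hXm
  have hval : ∀ i, ∫ ω, vertexAngle (fun j => X j ω) i ∂P =
      (stdGaussian (sumZero d)).real (vertexCone d i) := fun i => by
    have hi := (integrable_vertexAngle hd hE i).aestronglyMeasurable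
    rw [← integral_vertexAngle hd hE i, ← hmap]
    rw [← hmap] at hi
    exact (integral_map hXm hi).symm
  have hsum : ∫ ω, angleSum (fun j => X j ω) ∂P =
      ∑ i, (stdGaussian (sumZero d)).real (vertexCone d i) := by
    simp only [angleSum]
    rw [integral_finsetSum _ fun i _ => hint i]
    simp only [hval]
  have hreg := vertexAngle_of_dist_eq hd (affineIndependent_regularVertices d)
    (dist_regularVertices d)
  refine ⟨?_, integrable_finsetSum _ fun i _ => hint i, fun n T hT => ?_, ?_, hint 0, ?_⟩
  · have := ae_affineIndependent_pi_stdGaussian (E := EuclideanSpace ℝ (Fin d)) (d + 1) (by omega)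
    rw [← hmap] at this
    exact ae_of_ae_map hXm this
  · obtain ⟨r, hr⟩ := hT
    rw [hsum, angleSum]
    exact Finset.sum_congr rfl fun i _ => (vertexAngle_of_dist_eq hd T.independent hr i).symm
  · rw [hsum, angleSum]
    exact Finset.sum_congr rfl fun i _ => (hreg i).symm
  · rw [hval, hreg]
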